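/- Throughout, matrices are complex. For a square matrix $M$ with nonzero entries, $M^{(-)}$ denotes its Schur (entrywise) inverse, and $\circ$ denotes the Schur (entrywise) product. A $v\times v$ matrix $M$ with nonzero entries is type II if $M (M^{(-)})^T = vI$. For $n\times n$ matrices $A,B$, let $X_A(M)=AM$ and $\Delta_B(M)=B\circ M$ for $M\in \mathrm{Mat}_n(\mathbb C)$. The pair $(A,B)$ is a one-sided Jones pair if $X_A$ and $\Delta_B$ are invertible and $X_A\Delta_BX_A=\Delta_BX_A\Delta_B$; it is a Jones pair if $(A,B)$ and $(A,B^T)$ are one-sided Jones pairs; a Jones pair $(A,B)$ is invertible if moreover all entries of $A$ are nonzero and $B$ is invertible. Let $N_{A,B}$ be the algebra of matrices $R$ for which every vector $Ae_i\circ Be_j$ is an eigenvector; write $\Theta_{A,B}(R)$ for the matrix $S$ with $R(Ae_i\circ Be_j)=S_{ij}(Ae_i\circ Be_j)$ for all $i,j$. For $A$ with nonzero entries put $N_A=N_{A,A^{(-)}}$ (the Nomura algebra of $A$) and $\Theta_A=\Theta_{A,A^{(-)}}$. The basis of principal idempotents of such an algebra is its basis consisting of mutually orthogonal idempotents with sum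 $I$; the basis of Schur idempotents is its basis consisting of matrices that are mutually orthogonal idempotents for the Schur product, with sum the all-ones matrix $J$. (These bases are unique up to order when they exist.) **Theorem.** Let $(A,B)$ be an $n\times n$ invertible Jones pair, let $C$ be an invertible diagonal matrix with $A^T=C^{-2}AC^2$, and let $$W=\begin{pmatrix}A^T&-A^T\\ (B^{(-)})^TC&(B^{(-)})^TC\end{pmatrix}.$$ Then $W$ is type II, $\dim N_A=\dim N_{A,B}=:r$, and $N_A$ and $N_{A,B}$ have bases of principal idempotents $\{E_0,\dots,E_{r-1}\}$ and $\{F_0,\dots,F_{r-1}\}$, respectively. For these, the $2r$ matrices $$\begin{pmatrix}\Theta_A(E_i)&0\\0&\Theta_B(E_i)^T\end{pmatrix},\qquad \begin{pmatrix}0&\Theta_{A,B}(F_j)\\ \Theta_{A,B}(C^2F_j^TC^{-2})^T&0\end{pmatrix}\qquad(0\le i,j\le r-1)$$ form the basis of Schur idempotents of $N_W$, and the $2r$ matrices $$\frac12\begin{pmatrix}E_i^T&E_i^T\\E_i^T&E_i^T\end{pmatrix},\qquad \frac12\begin{pmatrix}CF_j^TC^{-1}&-CF_j^TC^{-1}\\-CF_j^TC^{-1}&CF_j^TC^{-1}\end{pmatrix}\qquad(0\le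 i,j\le r-1)$$ form the basis of principal idempotents of $N_{W^T}$. Consequently $\dim N_W=\dim N_{W^T}=2\dim N_A$. -/

import Mathlib

open scoped Matrix

namespace JonesPairs

variable {V ι : Type*} [Fintype V] [DecidableEq V] [Fintype ι]

/-- The operator `X_A : M ↦ A M` on square matrices. -/
def opX (A : Matrix V V ℂ) : Module.End ℂ (Matrix V V ℂ) :=
  LinearMap.mulLeft ℂ A

/-- The operator `Δ_B : M ↦ B ∘ M` (Schur, i.e. entrywise, multiplication by `B`). -/
def opD (B : Matrix V V ℂ) : Module.End ℂ (Matrix V V ℂ) where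
  toFun M := B ⊙ M
  map_add' M N := Matrix.hadamard_add B M N
  map_smul' c M := Matrix.hadamard_smul B M c

/-- `(A, B)` is a one-sided Jones pair: `X_A` and `Δ_B` are invertible and satisfy the
braid relation `X_A Δ_B X_A = Δ_B X_A Δ_B`. -/
def IsOneSidedJonesPair (A B : Matrix V V ℂ) : Prop :=
  IsUnit (opX A) ∧ IsUnit (opD B) ∧ opX A * opD B * opX A = opD B * opX A * opD B

/-- `(A, B)` is a Jones pair: both `(A, B)` and `(A, Bᵀ)` are one-sided Jones pairs. -/
def IsJonesPair (A B : Matrix V V ℂ) : Prop :=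
  IsOneSidedJonesPair A B ∧ IsOneSidedJonesPair A Bᵀ

/-- The Jones pair `(A, B)` is invertible: moreover `A` is Schur invertible and `B` is
invertible. -/
def IsInvertibleJonesPair (A B : Matrix V V ℂ) : Prop :=
  IsJonesPair A B ∧ (∀ i j, A i j ≠ 0) ∧ IsUnit B

/-- The Schur (entrywise) inverse `A^{(-)}`. -/
noncomputable def schurInv (A : Matrix V V ℂ) : Matrix V V ℂ :=
  A.map fun z => z⁻¹

/-- `A` is type II: its entries are nonzero and `A (A^{(-)})ᵀ = |V| I`. -/
def IsTypeII (A : Matrix V V ℂ) : Prop :=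
  (∀ i j, A i j ≠ 0) ∧ A * (schurInv A)ᵀ = (Fintype.card V : ℂ) • (1 : Matrix V V ℂ)

/-- The Schur product `A e_i ∘ B e_j` of column `i` of `A` and column `j` of `B`. -/
def eigVec (A B : Matrix V V ℂ) (i j : V) : V → ℂ :=
  fun k => A k i * B k j

/-- `S` records eigenvalues of `R`: `R (A e_i ∘ B e_j) = S_{ij} (A e_i ∘ B e_j)`. -/
def IsEigenvalueMatrix (A B R S : Matrix V V ℂ) : Prop :=
  ∀ i j, R *ᵥ eigVec A B i j = S i j • eigVec A B i j

/-- The algebra `N_{A,B}` of matrices having all vectors `A e_i ∘ B e_j` as eigenvectors. -/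
def nomura₂ (A B : Matrix V V ℂ) : Subalgebra ℂ (Matrix V V ℂ) where
  carrier := {R | ∃ S, IsEigenvalueMatrix A B R S}
  mul_mem' := by
    rintro R R' ⟨S, hS⟩ ⟨S', hS'⟩
    refine ⟨S ⊙ S', fun i j => ?_⟩
    rw [← Matrix.mulVec_mulVec, hS' i j, Matrix.mulVec_smul, hS i j, smul_smul,
      Matrix.hadamard_apply, mul_comm]
  add_mem' := by
    rintro R R' ⟨S, hS⟩ ⟨S', hS'⟩
    refine ⟨S + S', fun i j => ?_⟩
    rw [Matrix.add_mulVec, hS i j, hS' i j, Matrix.add_apply, add_smul]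
  algebraMap_mem' c := by
    refine ⟨Matrix.of fun _ _ => c, fun i j => ?_⟩
    rw [Algebra.algebraMap_eq_smul_one, Matrix.smul_mulVec, Matrix.one_mulVec, Matrix.of_apply]

/-- The Nomura algebra `N_A = N_{A, A^{(-)}}`. -/
noncomputable def nomura (A : Matrix V V ℂ) : Subalgebra ℂ (Matrix V V ℂ) :=
  nomura₂ A (schurInv A)

open Classical in
/-- `Θ_{A,B}(R)`, the matrix of eigenvalues of `R ∈ N_{A,B}`. It is unique as soon as no vector
`A e_i ∘ B e_j` vanishes; the value is `0` outside `N_{A,B}`. -/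
noncomputable def Theta₂ (A B R : Matrix V V ℂ) : Matrix V V ℂ :=
  if h : ∃ S, IsEigenvalueMatrix A B R S then h.choose else 0

/-- `Θ_A = Θ_{A, A^{(-)}}`. -/
noncomputable def Theta (A R : Matrix V V ℂ) : Matrix V V ℂ :=
  Theta₂ A (schurInv A) R

/-- `E` is the basis of principal idempotents of the algebra `N`: a basis of `N` made of
mutually orthogonal idempotents with sum `I`. -/
def IsPrincipalIdempotentBasis (N : Subalgebra ℂ (Matrix V V ℂ)) (E : ι → Matrix V V ℂ) : Prop :=
  LinearIndependent ℂ E ∧ Submodule.span ℂ (Set.range E) = Subalgebra.toSubmodule N ∧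
    (∀ i, E i * E i = E i) ∧ (∀ i j, i ≠ j → E i * E j = 0) ∧ ∑ i, E i = 1

/-- `E` is the basis of Schur idempotents of `N`: a basis of `N` made of idempotents for the
Schur product that are mutually orthogonal for it, with sum the all-ones matrix `J`. -/
def IsSchurIdempotentBasis (N : Subalgebra ℂ (Matrix V V ℂ)) (E : ι → Matrix V V ℂ) : Prop :=
  LinearIndependent ℂ E ∧ Submodule.span ℂ (Set.range E) = Subalgebra.toSubmodule N ∧
    (∀ i, E i ⊙ E i = E i) ∧ (∀ i j, i ≠ j → E i ⊙ E j = 0) ∧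
    ∑ i, E i = Matrix.of fun _ _ => 1

/-- The block matrix `W = [[Aᵀ, -Aᵀ], [(B^{(-)})ᵀ C, (B^{(-)})ᵀ C]]`. -/
noncomputable def matrixW (A B C : Matrix V V ℂ) : Matrix (V ⊕ V) (V ⊕ V) ℂ :=
  Matrix.fromBlocks Aᵀ (-Aᵀ) ((schurInv B)ᵀ * C) ((schurInv B)ᵀ * C)

end JonesPairs

open JonesPairs

/-!
Expanding in the columns of a type II matrix `B` shows that the eigenvalue matrix `S` of
`R ∈ N_{A,B}` is characterised by its action on quotients of rows: it sends the quotient of rows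
`i`, `j` of `B` to `n R i j` times the quotient of rows `j`, `i` of `A`. Composing such actions
gives `N_A = N_B`, identifies `N_{A,B}` with `N_A` through the Schur product with `Gᵀ` for any
Schur invertible `G ∈ N_{A,B}` whose eigenvalue matrix is invertible (`G = A` for a Jones pair),
and turns the matrix `n⁻¹ S` of a member of `N_W` into a member of `N_{Wᵀ}`.

The quotient vectors for `W` are stacks of `± u` and a multiple of `v`, where `u`, `v` are
quotients of rows of `A` and of `B`. Splitting into the even and odd parts in the sign of `u`
decouples the eigenvector equations for the blocks of a member of `N_W`: the diagonal blocks are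
governed by `N_A` and the off-diagonal ones by `N_{A,B}`. Hence the dual of `N_W` is the sum of a
copy of `N_A` and a copy of `N_{A,B}`, and the idempotents of the summands give those of both
algebras.
-/

namespace JonesPairs

section RowRatio

variable {V : Type*} {A B : Matrix V V ℂ}

/-- The entrywise quotient of row `i` of `A` by row `j` of `A`. It is the vector
`Aᵀ e_i ∘ (Aᵀ)^{(-)} e_j` of the Nomura algebra of `Aᵀ`. -/
noncomputable def rowRatio (A : Matrix V V ℂ) (i j : V) : V → ℂ :=
  fun k => A i k / A j k

@[simp]
lemma schurInv_apply (A : Matrix V V ℂ) (i j : V) : schurInv A i j = (A i j)⁻¹ := rfl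

@[simp]
lemma schurInv_schurInv (A : Matrix V V ℂ) : schurInv (schurInv A) = A := by
  ext i j
  simp

lemma schurInv_ne_zero (hA : ∀ i j, A i j ≠ 0) (i j : V) : schurInv A i j ≠ 0 :=
  inv_ne_zero (hA i j)

lemma rowRatio_schurInv (A : Matrix V V ℂ) (i j : V) :
    rowRatio (schurInv A) i j = rowRatio A j i := by
  ext k
  simp [rowRatio, div_eq_mul_inv, mul_comm]

lemma rowRatio_self (hA : ∀ i j, A i j ≠ 0) (i : V) : rowRatio A i i = 1 := by
  ext k
  simp [rowRatio, hA]

lemma eigVec_transpose_schurInv (A : Matrix V V ℂ) (i j : V) :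
    eigVec Aᵀ (schurInv Aᵀ) i j = rowRatio A i j := by
  ext k
  simp [eigVec, rowRatio, div_eq_mul_inv]

lemma rowRatio_ne_zero (hA : ∀ i j, A i j ≠ 0) (i j : V) : rowRatio A i j ≠ 0 :=
  fun h => div_ne_zero (hA i i) (hA j i) (congrFun h i)

lemma eigVec_ne_zero (hA : ∀ i j, A i j ≠ 0) (hB : ∀ i j, B i j ≠ 0) (i j : V) :
    eigVec A B i j ≠ 0 :=
  fun h => mul_ne_zero (hA i i) (hB i j) (congrFun h i)

end RowRatio

section TypeII

variable {V : Type*} [Fintype V] [DecidableEq V] {A : Matrix V V ℂ}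

lemma isTypeII_iff_sum_rowRatio :
    IsTypeII A ↔ (∀ i j, A i j ≠ 0) ∧ ∀ i j, i ≠ j → ∑ k, rowRatio A i j k = 0 := by
  refine and_congr_right fun hA => ?_
  have entry (i j : V) : (A * (schurInv A)ᵀ) i j = ∑ k, rowRatio A i j k := by
    simp [Matrix.mul_apply, rowRatio, div_eq_mul_inv]
  rw [← Matrix.ext_iff]
  refine ⟨fun h i j hij => by rw [← entry, h]; simp [hij], fun h i j => ?_⟩
  rw [entry]
  obtain rfl | hij := eq_or_ne i j
  · simp [rowRatio_self hA]
  · simp [h i j hij, hij]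

namespace IsTypeII

lemma sum_rowRatio (hA : IsTypeII A) (i j : V) :
    ∑ k, rowRatio A i j k = if i = j then (Fintype.card V : ℂ) else 0 := by
  split_ifs with hij
  · simp [hij, rowRatio_self hA.1]
  · exact (isTypeII_iff_sum_rowRatio.1 hA).2 i j hij

lemma isUnit (hA : IsTypeII A) : IsUnit A := by
  cases isEmpty_or_nonempty V
  · exact isUnit_of_subsingleton A
  · have hn : (Fintype.card V : ℂ) ≠ 0 := Nat.cast_ne_zero.2 Fintype.card_ne_zero
    refine IsUnit.of_mul_eq_one ((Fintype.card V : ℂ)⁻¹ • (schurInv A)ᵀ) ?_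
    rw [Matrix.mul_smul, hA.2, inv_smul_smul₀ hn]

lemma transpose_schurInv_mul (hA : IsTypeII A) :
    (schurInv A)ᵀ * A = (Fintype.card V : ℂ) • (1 : Matrix V V ℂ) := by
  rw [← hA.isUnit.mul_right_inj, ← Matrix.mul_assoc, hA.2, Matrix.smul_mul, Matrix.mul_smul,
    Matrix.one_mul, Matrix.mul_one]

lemma transpose (hA : IsTypeII A) : IsTypeII Aᵀ := by
  refine ⟨fun i j => hA.1 j i, ?_⟩
  change Aᵀ * schurInv A = _
  rw [← Matrix.transpose_inj, Matrix.transpose_mul, Matrix.transpose_transpose,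
    hA.transpose_schurInv_mul, Matrix.transpose_smul, Matrix.transpose_one]

lemma schurInv (hA : IsTypeII A) : IsTypeII (schurInv A) := by
  refine isTypeII_iff_sum_rowRatio.2 ⟨schurInv_ne_zero hA.1, fun i j hij => ?_⟩
  simp only [rowRatio_schurInv]
  exact (isTypeII_iff_sum_rowRatio.1 hA).2 j i hij.symm

end IsTypeII

end TypeII

lemma natCast_card_ne_zero {V : Type*} [Fintype V] (i : V) : (Fintype.card V : ℂ) ≠ 0 :=
  have : Nonempty V := ⟨i⟩
  Nat.cast_ne_zero.2 Fintype.card_ne_zero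

section EigenvalueMatrix

variable {V : Type*} [Fintype V] {A B R S R' S' : Matrix V V ℂ}

namespace IsEigenvalueMatrix

lemma swap (h : IsEigenvalueMatrix A B R S) : IsEigenvalueMatrix B A R Sᵀ := by
  intro i j
  have hcomm : eigVec B A i j = eigVec A B j i := funext fun k => mul_comm _ _
  rw [hcomm, h j i, Matrix.transpose_apply]

lemma mul (h : IsEigenvalueMatrix A B R S) (h' : IsEigenvalueMatrix A B R' S') :
    IsEigenvalueMatrix A B (R * R') (S ⊙ S') := by
  intro i j
  rw [← Matrix.mulVec_mulVec, h' i j, Matrix.mulVec_smul, h i j, smul_smul,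
    Matrix.hadamard_apply, mul_comm]

lemma zero : IsEigenvalueMatrix A B 0 0 := by
  intro i j
  simp

lemma one [DecidableEq V] : IsEigenvalueMatrix A B 1 (Matrix.of fun _ _ => 1) := by
  intro i j
  simp

lemma sum_smul {ι : Type*} [Fintype ι] {P Q : ι → Matrix V V ℂ}
    (h : ∀ k, IsEigenvalueMatrix A B (P k) (Q k)) (a : ι → ℂ) :
    IsEigenvalueMatrix A B (∑ k, a k • P k) (∑ k, a k • Q k) := by
  intro i j
  simp only [Matrix.sum_mulVec, Matrix.smul_mulVec, h _ i j, smul_smul, ← Finset.sum_smul,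
    Matrix.sum_apply, Matrix.smul_apply, smul_eq_mul]

lemma unique_right (hA : ∀ i j, A i j ≠ 0) (hB : ∀ i j, B i j ≠ 0)
    (h : IsEigenvalueMatrix A B R S) (h' : IsEigenvalueMatrix A B R S') : S = S' := by
  ext i j
  exact smul_left_injective ℂ (eigVec_ne_zero hA hB i j) ((h i j).symm.trans (h' i j))

lemma apply_eq_apply_of_eigVec_eq (hA : ∀ i j, A i j ≠ 0) (hB : ∀ i j, B i j ≠ 0)
    (h : IsEigenvalueMatrix A B R S) {i j i' j' : V} (heq : eigVec A B i j = eigVec A B i' j') :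
    S i j = S i' j' := by
  have hsmul := h i j
  rw [heq, h i' j'] at hsmul
  exact smul_left_injective ℂ (eigVec_ne_zero hA hB i' j') hsmul.symm

end IsEigenvalueMatrix

lemma isEigenvalueMatrix_Theta₂ [DecidableEq V] (h : R ∈ nomura₂ A B) :
    IsEigenvalueMatrix A B R (Theta₂ A B R) := by
  rw [Theta₂, dif_pos (show ∃ S, IsEigenvalueMatrix A B R S from h)]
  exact h.choose_spec

lemma nomura₂_comm [DecidableEq V] (A B : Matrix V V ℂ) : nomura₂ A B = nomura₂ B A :=
  le_antisymm (fun _ ⟨_, h⟩ => ⟨_, h.swap⟩) (fun _ ⟨_, h⟩ => ⟨_, h.swap⟩)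

lemma isEigenvalueMatrix_iff_mul_diagonal [DecidableEq V] :
    IsEigenvalueMatrix A B R S ↔ ∀ k, R * (Matrix.diagonal (A.col k) * B) =
      Matrix.diagonal (A.col k) * B * Matrix.diagonal (S k) := by
  refine forall_congr' fun k => ?_
  rw [← Matrix.ext_iff, forall_comm]
  refine forall_congr' fun l => funext_iff.trans (forall_congr' fun i => ?_)
  rw [Matrix.mul_apply, Matrix.mul_diagonal, Matrix.diagonal_mul, mul_comm _ (S k l)]
  simp [Matrix.mulVec, dotProduct, eigVec]

end EigenvalueMatrix

section Duality

variable {V : Type*} [Fintype V] [DecidableEq V] {A B D R S R' S' G T : Matrix V V ℂ}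

lemma diagonal_mul_mul_diagonal_mul_transpose_schurInv_apply (a s : V → ℂ) (i j : V) :
    (Matrix.diagonal a * B * Matrix.diagonal s * (schurInv B)ᵀ) i j =
      a i * (s ⬝ᵥ rowRatio B i j) := by
  rw [Matrix.mul_apply, dotProduct, Finset.mul_sum]
  refine Finset.sum_congr rfl fun l _ => ?_
  rw [Matrix.mul_diagonal, Matrix.diagonal_mul, Matrix.transpose_apply, schurInv_apply, rowRatio]
  ring

theorem isEigenvalueMatrix_iff_mulVec_rowRatio (hA : ∀ i j, A i j ≠ 0) (hB : IsTypeII B) :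
    IsEigenvalueMatrix A B R S ↔
      ∀ i j, S *ᵥ rowRatio B i j = ((Fintype.card V : ℂ) * R i j) • rowRatio A j i := by
  have hunit : IsUnit (schurInv B)ᵀ := (Matrix.isUnit_transpose _).2 hB.schurInv.isUnit
  have column (k : V) : R * (Matrix.diagonal (A.col k) * B) =
        Matrix.diagonal (A.col k) * B * Matrix.diagonal (S k) ↔
      ∀ i j, (S *ᵥ rowRatio B i j) k =
        (((Fintype.card V : ℂ) * R i j) • rowRatio A j i) k := by
    rw [← hunit.mul_left_inj, ← Matrix.ext_iff]
    refine forall₂_congr fun i j => ?_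
    have hleft : (R * (Matrix.diagonal (A.col k) * B) * (schurInv B)ᵀ) i j =
        Fintype.card V * R i j * A j k := by
      simp [hB.2, mul_assoc]
    rw [hleft, diagonal_mul_mul_diagonal_mul_transpose_schurInv_apply, Pi.smul_apply, smul_eq_mul,
      rowRatio, mul_div_assoc', eq_div_iff (hA i k), eq_comm, mul_comm]
    rfl
  simp only [isEigenvalueMatrix_iff_mul_diagonal, column, funext_iff]
  exact ⟨fun h i j k => h k i j, fun h k i j => h i j k⟩

theorem isEigenvalueMatrix_iff_transpose (hA : IsTypeII A) :
    IsEigenvalueMatrix A (schurInv A) R ((Fintype.card V : ℂ) • S) ↔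
      IsEigenvalueMatrix Aᵀ (schurInv Aᵀ) S Rᵀ := by
  rw [isEigenvalueMatrix_iff_mulVec_rowRatio hA.1 hA.schurInv, forall_comm]
  refine forall_congr' fun j => forall_congr' fun i => ?_
  have hn : (Fintype.card V : ℂ) ≠ 0 := natCast_card_ne_zero i
  rw [rowRatio_schurInv, eigVec_transpose_schurInv, Matrix.smul_mulVec, mul_smul,
    smul_right_inj hn, Matrix.transpose_apply]

lemma exists_isEigenvalueMatrix_transpose (hA : IsTypeII A) (hS : S ∈ nomura A) :
    ∃ R ∈ nomura Aᵀ, IsEigenvalueMatrix Aᵀ (schurInv Aᵀ) R Sᵀ := by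
  obtain ⟨R, hR⟩ := hS
  have hcard : R = (Fintype.card V : ℂ) • ((Fintype.card V : ℂ)⁻¹ • R) := by
    ext i j
    exact (mul_inv_cancel_left₀ (natCast_card_ne_zero i) (R i j)).symm
  rw [hcard, isEigenvalueMatrix_iff_transpose hA] at hR
  exact ⟨_, ⟨_, hR⟩, hR⟩

namespace IsEigenvalueMatrix

lemma unique_left (hA : ∀ i j, A i j ≠ 0) (hB : IsTypeII B)
    (h : IsEigenvalueMatrix A B R S) (h' : IsEigenvalueMatrix A B R' S) : R = R' := by
  rw [isEigenvalueMatrix_iff_mulVec_rowRatio hA hB] at h h'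
  ext i j
  have hn : (Fintype.card V : ℂ) ≠ 0 := natCast_card_ne_zero i
  exact mul_left_cancel₀ hn
    (smul_left_injective ℂ (rowRatio_ne_zero hA j i) ((h i j).symm.trans (h' i j)))

lemma transpose (hA : ∀ i j, A i j ≠ 0) (hB : IsTypeII B) (h : IsEigenvalueMatrix A B R S) :
    IsEigenvalueMatrix (schurInv A) (schurInv B) Rᵀ S := by
  rw [isEigenvalueMatrix_iff_mulVec_rowRatio hA hB] at h
  refine (isEigenvalueMatrix_iff_mulVec_rowRatio (schurInv_ne_zero hA)
    hB.schurInv).2 fun i j => ?_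
  rw [rowRatio_schurInv, rowRatio_schurInv, h j i, Matrix.transpose_apply]

lemma comp (hA : ∀ i j, A i j ≠ 0) (hB : IsTypeII B) (hD : IsTypeII D)
    (h : IsEigenvalueMatrix A B R S) (h' : IsEigenvalueMatrix B D R' S') :
    IsEigenvalueMatrix A (schurInv D) (R ⊙ R'ᵀ) ((Fintype.card V : ℂ)⁻¹ • (S * S')) := by
  rw [isEigenvalueMatrix_iff_mulVec_rowRatio hA hB] at h
  rw [isEigenvalueMatrix_iff_mulVec_rowRatio hB.1 hD] at h'
  refine (isEigenvalueMatrix_iff_mulVec_rowRatio hA hD.schurInv).2 fun i j => ?_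
  have hn := natCast_card_ne_zero i
  rw [rowRatio_schurInv, Matrix.smul_mulVec, ← Matrix.mulVec_mulVec, h' j i, Matrix.mulVec_smul,
    h i j, smul_smul, smul_smul, Matrix.hadamard_apply, Matrix.transpose_apply]
  congr 1
  field_simp

lemma inverse (hA : IsTypeII A) (hB : IsTypeII B) (hG : ∀ i j, G i j ≠ 0) (hT : IsUnit T)
    (h : IsEigenvalueMatrix A B G T) :
    IsEigenvalueMatrix B A (schurInv Gᵀ) ((Fintype.card V : ℂ) ^ 2 • T⁻¹) := by
  rw [isEigenvalueMatrix_iff_mulVec_rowRatio hA.1 hB] at h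
  refine (isEigenvalueMatrix_iff_mulVec_rowRatio hB.1 hA).2 fun i j => ?_
  have hn := natCast_card_ne_zero i
  have hT' : T⁻¹ * T = 1 := Matrix.nonsing_inv_mul T ((Matrix.isUnit_iff_isUnit_det T).1 hT)
  have hrow : rowRatio A i j = ((Fintype.card V : ℂ) * G j i)⁻¹ • (T *ᵥ rowRatio B j i) := by
    rw [h j i, inv_smul_smul₀ (mul_ne_zero hn (hG j i))]
  rw [hrow, Matrix.mulVec_smul, Matrix.smul_mulVec, Matrix.mulVec_mulVec, hT', Matrix.one_mulVec,
    smul_smul, schurInv_apply, Matrix.transpose_apply]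
  congr 1
  field_simp

end IsEigenvalueMatrix

end Duality

section Twist

variable {V : Type*} [Fintype V] [DecidableEq V] {C : Matrix V V ℂ} {c : V → ℂ}

/-- The map `R ↦ C Rᵀ C⁻¹`, an anti-automorphism of the matrix algebra when `C` is invertible. For
the diagonal matrix `C` of `W` it embeds `N_{A,B}` into the blocks of `N_{Wᵀ}`; for `C²` it
preserves `N_{A,B}` and links the two off-diagonal blocks of a member of `N_W`. -/
noncomputable def twist (C : Matrix V V ℂ) : Matrix V V ℂ →ₗ[ℂ] Matrix V V ℂ where
  toFun R := C * Rᵀ * C⁻¹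
  map_add' R R' := by simp [Matrix.mul_add, Matrix.add_mul]
  map_smul' a R := by simp

lemma twist_apply (C R : Matrix V V ℂ) : twist C R = C * Rᵀ * C⁻¹ := rfl

lemma isUnit_diagonal (hc : ∀ i, c i ≠ 0) : IsUnit (Matrix.diagonal c) :=
  Matrix.isUnit_diagonal.2 (Pi.isUnit_iff.2 fun i => (hc i).isUnit)

lemma inv_diagonal (hc : ∀ i, c i ≠ 0) : (Matrix.diagonal c)⁻¹ = Matrix.diagonal c⁻¹ := by
  refine Matrix.inv_eq_right_inv ?_
  rw [Matrix.diagonal_mul_diagonal, ← Matrix.diagonal_one]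
  exact congrArg Matrix.diagonal (funext fun i => mul_inv_cancel₀ (hc i))

lemma twist_diagonal_apply (hc : ∀ i, c i ≠ 0) (R : Matrix V V ℂ) (i j : V) :
    twist (Matrix.diagonal c) R i j = c i * R j i / c j := by
  rw [twist_apply, inv_diagonal hc, Matrix.mul_diagonal, Matrix.diagonal_mul, Pi.inv_apply,
    Matrix.transpose_apply, div_eq_mul_inv]

lemma twist_one (hC : IsUnit C) : twist C 1 = 1 := by
  rw [twist_apply, Matrix.transpose_one, Matrix.mul_one,
    Matrix.mul_nonsing_inv C ((Matrix.isUnit_iff_isUnit_det C).1 hC)]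

lemma twist_mul_twist (hC : IsUnit C) (R R' : Matrix V V ℂ) :
    twist C R * twist C R' = twist C (R' * R) := by
  have hCC : C⁻¹ * C = 1 := Matrix.nonsing_inv_mul C ((Matrix.isUnit_iff_isUnit_det C).1 hC)
  calc C * Rᵀ * C⁻¹ * (C * R'ᵀ * C⁻¹) = C * Rᵀ * (C⁻¹ * C) * R'ᵀ * C⁻¹ := by noncomm_ring
    _ = C * (R' * R)ᵀ * C⁻¹ := by
      rw [hCC, Matrix.mul_one, Matrix.transpose_mul, Matrix.mul_assoc C]

lemma twist_injective (hC : IsUnit C) : Function.Injective (twist C) := by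
  intro R R' h
  have hinv : IsUnit C⁻¹ := Matrix.isUnit_nonsing_inv_iff.2 hC
  exact Matrix.transpose_injective (hC.mul_right_injective (hinv.mul_left_injective h))

end Twist

section NomuraAlgebra

variable {V : Type*} [Fintype V] [DecidableEq V] {A B G R T : Matrix V V ℂ}

lemma transpose_mem_nomura (hA : IsTypeII A) (h : R ∈ nomura A) : Rᵀ ∈ nomura A := by
  obtain ⟨S, hS⟩ := h
  have hS' := (hS.transpose hA.1 hA.schurInv).swap
  rw [schurInv_schurInv] at hS'
  exact ⟨Sᵀ, hS'⟩

theorem mem_nomura₂_iff_hadamard_mem_nomura (hA : IsTypeII A) (hB : IsTypeII B)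
    (hG : IsEigenvalueMatrix A B G T) (hG0 : ∀ i j, G i j ≠ 0) (hT : IsUnit T) :
    R ∈ nomura₂ A B ↔ Gᵀ ⊙ R ∈ nomura A := by
  constructor
  · rintro ⟨S, hS⟩
    rw [Matrix.hadamard_comm]
    exact ⟨_, hS.comp hA.1 hB hA hG.swap⟩
  · rintro ⟨S, hS⟩
    have hT' : IsUnit Tᵀ := (Matrix.isUnit_transpose _).2 hT
    have hinv := (hG.swap.inverse hB hA hG0 hT').transpose hA.1 hB
    have hcomp := hS.comp hA.1 hA.schurInv hB.schurInv hinv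
    have hcancel : Gᵀ ⊙ R ⊙ (schurInv Gᵀ)ᵀᵀ = R := by
      ext i j
      simp [mul_comm (G j i), hG0 j i]
    rw [schurInv_schurInv, hcancel] at hcomp
    exact ⟨_, hcomp⟩

theorem nomura_eq_nomura (hA : IsTypeII A) (hB : IsTypeII B) (hG : IsEigenvalueMatrix A B G T)
    (hG0 : ∀ i j, G i j ≠ 0) (hT : IsUnit T) : nomura A = nomura B := by
  have hT' : IsUnit Tᵀ := (Matrix.isUnit_transpose _).2 hT
  ext R
  have hcancel : Gᵀ ⊙ (schurInv Gᵀ ⊙ R) = R := by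
    ext i j
    simp [hG0 j i]
  rw [← hcancel, ← mem_nomura₂_iff_hadamard_mem_nomura hA hB hG hG0 hT, nomura₂_comm,
    mem_nomura₂_iff_hadamard_mem_nomura hB hA hG.swap hG0 hT']

theorem finrank_nomura_eq_finrank_nomura₂ (hA : IsTypeII A) (hB : IsTypeII B)
    (hG : IsEigenvalueMatrix A B G T) (hG0 : ∀ i j, G i j ≠ 0) (hT : IsUnit T) :
    Module.finrank ℂ (nomura A) = Module.finrank ℂ (nomura₂ A B) := by
  have hinj : Function.Injective (opD Gᵀ) := fun R R' h => by
    ext i j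
    exact mul_left_cancel₀ (hG0 j i) (congrFun₂ h i j)
  let e := LinearEquiv.ofInjectiveEndo (opD Gᵀ) hinj
  have hmap : (Subalgebra.toSubmodule (nomura₂ A B)).map (e : Matrix V V ℂ →ₗ[ℂ] Matrix V V ℂ) =
      Subalgebra.toSubmodule (nomura A) := by
    ext R
    rw [Submodule.mem_map_equiv, Subalgebra.mem_toSubmodule,
      mem_nomura₂_iff_hadamard_mem_nomura hA hB hG hG0 hT, Subalgebra.mem_toSubmodule]
    exact iff_of_eq (congrArg (· ∈ nomura A) (e.apply_symm_apply R))
  exact (congrArg (fun N : Submodule ℂ _ => Module.finrank ℂ N) hmap).symm.trans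
    (LinearEquiv.finrank_map_eq e _)

theorem twist_mem_nomura₂ (hA : IsTypeII A) (hB : IsTypeII B)
    (hG : IsEigenvalueMatrix A B G T) (hG0 : ∀ i j, G i j ≠ 0) (hT : IsUnit T)
    {d : V → ℂ} (hd : ∀ i, d i ≠ 0) (hGd : Gᵀ = (Matrix.diagonal d)⁻¹ * G * Matrix.diagonal d)
    (hR : R ∈ nomura₂ A B) : twist (Matrix.diagonal d) R ∈ nomura₂ A B := by
  rw [mem_nomura₂_iff_hadamard_mem_nomura hA hB hG hG0 hT] at hR ⊢
  convert transpose_mem_nomura hA hR using 1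
  ext i j
  have hi := hd i
  have hj := hd j
  rw [Matrix.hadamard_apply, twist_diagonal_apply hd, Matrix.transpose_apply (Gᵀ ⊙ R),
    Matrix.hadamard_apply, Matrix.transpose_apply G j i, hGd, inv_diagonal hd, Matrix.mul_diagonal,
    Matrix.diagonal_mul, Pi.inv_apply]
  field_simp

end NomuraAlgebra

section JonesPair

variable {V : Type*} [Fintype V] [DecidableEq V] {A B : Matrix V V ℂ}

namespace IsOneSidedJonesPair

lemma isUnit_left (h : IsOneSidedJonesPair A B) : IsUnit A := by
  obtain ⟨M, hM⟩ := ((Module.End.isUnit_iff _).1 h.1).2 1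
  exact IsUnit.of_mul_eq_one M hM

lemma right_ne_zero (h : IsOneSidedJonesPair A B) (i j : V) : B i j ≠ 0 := by
  obtain ⟨M, hM⟩ := ((Module.End.isUnit_iff _).1 h.2.1).2 (Matrix.of fun _ _ => 1)
  exact left_ne_zero_of_mul_eq_one (congrFun₂ hM i j)

theorem isEigenvalueMatrix (h : IsOneSidedJonesPair A B) : IsEigenvalueMatrix A B A B := by
  intro i j
  ext k
  have hbraid := congrFun₂ (LinearMap.congr_fun h.2.2 (Matrix.single i j 1)) k j
  have hentry : ∑ l, A k l * (B l j * A l i) = B k j * (A k i * B i j) := by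
    simpa [opX, opD, Matrix.mul_apply, Matrix.single_apply, ite_and] using hbraid
  calc (A *ᵥ eigVec A B i j) k = ∑ l, A k l * (B l j * A l i) := by
        simp [Matrix.mulVec, dotProduct, eigVec, mul_comm]
    _ = B k j * (A k i * B i j) := hentry
    _ = B i j * (A k i * B k j) := by ring

lemma one_vecMul (h : IsOneSidedJonesPair A B) : 1 ᵥ* B = fun _ => A.trace := by
  ext j
  have hdiag : IsUnit (Matrix.diagonal (B.col j)) := isUnit_diagonal fun k => h.right_ne_zero k j
  obtain ⟨U, hU⟩ := hdiag.mul h.isUnit_left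
  have hconj : A = U * Matrix.diagonal (Bᵀ j) * (U⁻¹ : (Matrix V V ℂ)ˣ).val := by
    have hAU := isEigenvalueMatrix_iff_mul_diagonal.1 h.isEigenvalueMatrix.swap j
    rw [← hU] at hAU
    rw [← hAU, Units.mul_inv_cancel_right]
  rw [hconj, Matrix.trace_units_conj, Matrix.trace_diagonal]
  simp [Matrix.vecMul, dotProduct]

lemma inv_mul_diag_vecMul (h : IsOneSidedJonesPair A B) (i : V) :
    (fun l => A⁻¹ i l * A l i) ᵥ* B = fun _ => A i i := by
  ext m
  have hinv : A⁻¹ * A = 1 :=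
    Matrix.nonsing_inv_mul A ((Matrix.isUnit_iff_isUnit_det A).1 h.isUnit_left)
  have heig := congrFun (congrArg (A⁻¹ *ᵥ ·) (h.isEigenvalueMatrix i m)) i
  simp only [Matrix.mulVec_mulVec, hinv, Matrix.one_mulVec, Matrix.mulVec_smul] at heig
  refine mul_left_cancel₀ (h.right_ne_zero i m) ?_
  rw [mul_comm _ (A i i)]
  refine .trans ?_ heig.symm
  simp [Matrix.vecMul, Matrix.mulVec, dotProduct, eigVec, mul_assoc]

theorem isTypeII_left (h : IsOneSidedJonesPair A B) (hA : ∀ i j, A i j ≠ 0) (hB : IsUnit B) :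
    IsTypeII A := by
  have hdet := (Matrix.isUnit_iff_isUnit_det A).1 h.isUnit_left
  have hprod (i l : V) : A.trace * (A⁻¹ i l * A l i) = A i i := by
    have hvec : A.trace • (fun l => A⁻¹ i l * A l i) = A i i • 1 := by
      apply Matrix.vecMul_injective_of_isUnit hB
      simp only [Matrix.smul_vecMul, h.inv_mul_diag_vecMul, h.one_vecMul]
      ext
      simp [mul_comm]
    simpa using congrFun hvec l
  have htrace (i : V) : A.trace = Fintype.card V * A i i := by
    have hsum : ∑ l, A⁻¹ i l * A l i = 1 := by
      rw [← Matrix.mul_apply, Matrix.nonsing_inv_mul A hdet, Matrix.one_apply_eq]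
    rw [← mul_one A.trace, ← hsum, Finset.mul_sum, Finset.sum_congr rfl fun l _ => hprod i l]
    simp
  have hschur : (schurInv A)ᵀ = (Fintype.card V : ℂ) • A⁻¹ := by
    ext i l
    have hil := hprod i l
    rw [htrace i] at hil
    rw [Matrix.transpose_apply, schurInv_apply, Matrix.smul_apply, smul_eq_mul]
    refine inv_eq_of_mul_eq_one_left (mul_left_cancel₀ (hA i i) ?_)
    linear_combination hil
  refine ⟨hA, ?_⟩
  rw [hschur, Matrix.mul_smul, Matrix.mul_nonsing_inv A hdet]

end IsOneSidedJonesPair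

theorem IsJonesPair.isTypeII_right (h : IsJonesPair A B) (hA : IsTypeII A) : IsTypeII B := by
  have hB := h.1.right_ne_zero
  refine isTypeII_iff_sum_rowRatio.2 ⟨hB, fun i j hij => ?_⟩
  have hdual := (isEigenvalueMatrix_iff_mulVec_rowRatio hB hA).1 h.1.isEigenvalueMatrix.swap j i
  have hsum : A.trace * ∑ k, rowRatio A j i k =
      (Fintype.card V * A j i) * ∑ k, rowRatio B i j k := by
    have hdot := congrArg (1 ⬝ᵥ ·) hdual
    simp only [Matrix.dotProduct_mulVec, h.2.one_vecMul] at hdot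
    simpa [dotProduct, Finset.mul_sum] using hdot
  rw [hA.sum_rowRatio, if_neg hij.symm, mul_zero] at hsum
  exact (mul_eq_zero.1 hsum.symm).resolve_left (mul_ne_zero (natCast_card_ne_zero i) (hA.1 j i))

end JonesPair

section BlockMatrix

variable {V : Type*} [Fintype V] {P Q U T : Matrix V V ℂ} {x y : V → ℂ} {a b : ℂ}

lemma fromBlocks_mulVec_elim_and_neg_iff :
    (Matrix.fromBlocks P Q U T *ᵥ Sum.elim x y = (a + b) • Sum.elim x y ∧
        Matrix.fromBlocks P Q U T *ᵥ Sum.elim (-x) y = (a - b) • Sum.elim (-x) y) ↔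
      (P *ᵥ x = a • x ∧ Q *ᵥ y = b • x) ∧ U *ᵥ x = b • y ∧ T *ᵥ y = a • y := by
  have pointwise (p q u t x y : ℂ) :
      ((p + q = (a + b) * x ∧ u + t = (a + b) * y) ∧
          -p + q = (a - b) * -x ∧ -u + t = (a - b) * y) ↔
        (p = a * x ∧ q = b * x) ∧ u = b * y ∧ t = a * y := by
    constructor
    · rintro ⟨⟨hx, hy⟩, hx', hy'⟩
      refine ⟨⟨?_, ?_⟩, ?_, ?_⟩ <;> grind
    · rintro ⟨⟨rfl, rfl⟩, rfl, rfl⟩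
      refine ⟨⟨?_, ?_⟩, ?_, ?_⟩ <;> ring
  simp only [Matrix.fromBlocks_mulVec, funext_iff, Sum.forall, ← forall_and]
  refine forall_congr' fun k => ?_
  rw [Pi.smul_apply a, Pi.smul_apply b, Pi.smul_apply b, Pi.smul_apply a]
  refine Iff.trans ?_ (pointwise _ _ _ _ (x k) (y k))
  simp [Matrix.mulVec_neg]

end BlockMatrix

section MatrixW

variable {V : Type*} [Fintype V] [DecidableEq V] {A B P Q U T X Y : Matrix V V ℂ} {c : V → ℂ}

lemma eigVec_matrixW_inl_inl (A B : Matrix V V ℂ) (c : V → ℂ) (i j : V) :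
    eigVec (matrixW A B (Matrix.diagonal c)) (schurInv (matrixW A B (Matrix.diagonal c)))
      (.inl i) (.inl j) = Sum.elim (rowRatio A i j) ((c i / c j) • rowRatio B j i) := by
  ext (k | k) <;> simp [eigVec, matrixW, rowRatio] <;> field_simp

lemma eigVec_matrixW_inr_inr (A B : Matrix V V ℂ) (c : V → ℂ) (i j : V) :
    eigVec (matrixW A B (Matrix.diagonal c)) (schurInv (matrixW A B (Matrix.diagonal c)))
      (.inr i) (.inr j) = Sum.elim (rowRatio A i j) ((c i / c j) • rowRatio B j i) := by
  ext (k | k) <;> simp [eigVec, matrixW, rowRatio] <;> field_simp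

lemma eigVec_matrixW_inl_inr (A B : Matrix V V ℂ) (c : V → ℂ) (i j : V) :
    eigVec (matrixW A B (Matrix.diagonal c)) (schurInv (matrixW A B (Matrix.diagonal c)))
      (.inl i) (.inr j) = Sum.elim (-rowRatio A i j) ((c i / c j) • rowRatio B j i) := by
  ext (k | k) <;> simp [eigVec, matrixW, rowRatio] <;> field_simp

lemma eigVec_matrixW_inr_inl (A B : Matrix V V ℂ) (c : V → ℂ) (i j : V) :
    eigVec (matrixW A B (Matrix.diagonal c)) (schurInv (matrixW A B (Matrix.diagonal c)))
      (.inr i) (.inl j) = Sum.elim (-rowRatio A i j) ((c i / c j) • rowRatio B j i) := by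
  ext (k | k) <;> simp [eigVec, matrixW, rowRatio] <;> field_simp

theorem isTypeII_matrixW (hA : IsTypeII A) (hB : IsTypeII B) (hc : ∀ i, c i ≠ 0) :
    IsTypeII (matrixW A B (Matrix.diagonal c)) := by
  suffices h : IsTypeII (matrixW A B (Matrix.diagonal c))ᵀ from h.transpose
  refine isTypeII_iff_sum_rowRatio.2 ⟨?_, ?_⟩
  · rintro (i | i) (j | j) <;> simp [matrixW, hA.1, hB.1, hc]
  · rintro (i | i) (j | j) hij <;>
      rw [← eigVec_transpose_schurInv, Matrix.transpose_transpose] <;>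
      obtain rfl | hne := eq_or_ne i j <;>
      simp_all [eigVec_matrixW_inl_inl, eigVec_matrixW_inr_inr, eigVec_matrixW_inl_inr,
        eigVec_matrixW_inr_inl, ← Finset.mul_sum, hA.sum_rowRatio, hB.sum_rowRatio, eq_comm]

lemma isEigenvalueMatrix_matrixW_iff_elim :
    IsEigenvalueMatrix (matrixW A B (Matrix.diagonal c))
        (schurInv (matrixW A B (Matrix.diagonal c))) (Matrix.fromBlocks P Q U T)
        (Matrix.fromBlocks (X + Y) (X - Y) (X - Y) (X + Y)) ↔
      ∀ i j, (P *ᵥ rowRatio A i j = X i j • rowRatio A i j ∧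
          Q *ᵥ ((c i / c j) • rowRatio B j i) = Y i j • rowRatio A i j) ∧
        U *ᵥ rowRatio A i j = Y i j • ((c i / c j) • rowRatio B j i) ∧
          T *ᵥ ((c i / c j) • rowRatio B j i) = X i j • ((c i / c j) • rowRatio B j i) := by
  simp only [← fromBlocks_mulVec_elim_and_neg_iff]
  constructor
  · intro h i j
    have hplus := h (.inl i) (.inl j)
    have hminus := h (.inl i) (.inr j)
    rw [eigVec_matrixW_inl_inl] at hplus
    rw [eigVec_matrixW_inl_inr] at hminus
    exact ⟨hplus, hminus⟩
  · rintro h (i | i) (j | j)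
    · rw [eigVec_matrixW_inl_inl]
      exact (h i j).1
    · rw [eigVec_matrixW_inl_inr]
      exact (h i j).2
    · rw [eigVec_matrixW_inr_inl]
      exact (h i j).2
    · rw [eigVec_matrixW_inr_inr]
      exact (h i j).1

theorem isEigenvalueMatrix_matrixW_iff (hc : ∀ i, c i ≠ 0) :
    IsEigenvalueMatrix (matrixW A B (Matrix.diagonal c))
        (schurInv (matrixW A B (Matrix.diagonal c))) (Matrix.fromBlocks P Q U T)
        (Matrix.fromBlocks (X + Y) (X - Y) (X - Y) (X + Y)) ↔
      ∀ i j, (P *ᵥ rowRatio A i j = X i j • rowRatio A i j ∧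
          Q *ᵥ rowRatio B j i = (c j / c i * Y i j) • rowRatio A i j) ∧
        U *ᵥ rowRatio A i j = (c i / c j * Y i j) • rowRatio B j i ∧
          T *ᵥ rowRatio B j i = X i j • rowRatio B j i := by
  rw [isEigenvalueMatrix_matrixW_iff_elim]
  refine forall₂_congr fun i j => ?_
  have hu : c i / c j ≠ 0 := div_ne_zero (hc i) (hc j)
  rw [Matrix.mulVec_smul, Matrix.mulVec_smul, ← eq_inv_smul_iff₀ hu, inv_div, smul_smul,
    smul_smul, mul_comm (Y i j), smul_comm (X i j), smul_right_inj hu]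

end MatrixW

section DualBlocks

variable {V : Type*} [Fintype V] [DecidableEq V] {A B C P Q U T E F : Matrix V V ℂ} {c : V → ℂ}
  {R : Matrix (V ⊕ V) (V ⊕ V) ℂ}

/-- The sum of `½ [[Eᵀ, Eᵀ], [Eᵀ, Eᵀ]]` and `½ [[F', -F'], [-F', F']]`, where `F' = C Fᵀ C⁻¹`. As
`E` and `F` run over `N_A` and `N_{A,B}`, it runs over `N_{Wᵀ}`. -/
noncomputable def dualBlocks (C : Matrix V V ℂ) :
    Matrix V V ℂ × Matrix V V ℂ →ₗ[ℂ] Matrix (V ⊕ V) (V ⊕ V) ℂ where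
  toFun p := (1 / 2 : ℂ) • Matrix.fromBlocks (p.1ᵀ + twist C p.2) (p.1ᵀ - twist C p.2)
    (p.1ᵀ - twist C p.2) (p.1ᵀ + twist C p.2)
  map_add' p q := by
    ext (i | i) (j | j) <;> simp <;> ring
  map_smul' a p := by
    ext (i | i) (j | j) <;> simp <;> ring

lemma dualBlocks_apply (C E F : Matrix V V ℂ) :
    dualBlocks C (E, F) = (1 / 2 : ℂ) • Matrix.fromBlocks (Eᵀ + twist C F) (Eᵀ - twist C F)
      (Eᵀ - twist C F) (Eᵀ + twist C F) := rfl

lemma dualBlocks_left (C E : Matrix V V ℂ) :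
    dualBlocks C (E, 0) = (1 / 2 : ℂ) • Matrix.fromBlocks Eᵀ Eᵀ Eᵀ Eᵀ := by
  simp [dualBlocks_apply]

lemma dualBlocks_right (C F : Matrix V V ℂ) :
    dualBlocks C (0, F) = (1 / 2 : ℂ) • Matrix.fromBlocks (C * Fᵀ * C⁻¹) (-(C * Fᵀ * C⁻¹))
      (-(C * Fᵀ * C⁻¹)) (C * Fᵀ * C⁻¹) := by
  simp [dualBlocks_apply, twist_apply]

lemma dualBlocks_one (hC : IsUnit C) : dualBlocks C 1 = 1 := by
  rw [← Prod.mk_one_one, dualBlocks_apply, twist_one hC, Matrix.transpose_one, sub_self,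
    Matrix.fromBlocks_smul, smul_zero, ← two_smul ℂ (1 : Matrix V V ℂ), smul_smul]
  norm_num [Matrix.fromBlocks_one]

lemma dualBlocks_mul_dualBlocks (hC : IsUnit C) (p q : Matrix V V ℂ × Matrix V V ℂ) :
    dualBlocks C p * dualBlocks C q = dualBlocks C (q * p) := by
  obtain ⟨E, F⟩ := p
  obtain ⟨E', F'⟩ := q
  have expand (X Y X' Y' : Matrix V V ℂ) :
      (1 / 2 : ℂ) • Matrix.fromBlocks (X + Y) (X - Y) (X - Y) (X + Y) *
          (1 / 2 : ℂ) • Matrix.fromBlocks (X' + Y') (X' - Y') (X' - Y') (X' + Y') =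
        (1 / 2 : ℂ) • Matrix.fromBlocks (X * X' + Y * Y') (X * X' - Y * Y')
          (X * X' - Y * Y') (X * X' + Y * Y') := by
    rw [Matrix.smul_mul, Matrix.mul_smul, smul_smul, Matrix.fromBlocks_multiply,
      Matrix.fromBlocks_smul, Matrix.fromBlocks_smul]
    congr 1 <;> simp only [mul_add, add_mul, mul_sub, sub_mul] <;> module
  rw [Prod.mk_mul_mk, dualBlocks_apply, dualBlocks_apply, dualBlocks_apply, expand,
    twist_mul_twist hC, ← Matrix.transpose_mul]

lemma dualBlocks_injective (hC : IsUnit C) : Function.Injective (dualBlocks C) := by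
  rintro ⟨E, F⟩ ⟨E', F'⟩ h
  obtain ⟨hplus, hminus, -, -⟩ :=
    Matrix.fromBlocks_inj.1 (smul_right_injective _ (by norm_num : (1 / 2 : ℂ) ≠ 0) h)
  have hE : Eᵀ = E'ᵀ := by
    calc Eᵀ = (1 / 2 : ℂ) • ((Eᵀ + twist C F) + (Eᵀ - twist C F)) := by module
      _ = (1 / 2 : ℂ) • ((E'ᵀ + twist C F') + (E'ᵀ - twist C F')) :=
        congrArg _ (congrArg₂ _ hplus hminus)
      _ = E'ᵀ := by module
  have hF : twist C F = twist C F' := by rw [hE] at hplus; exact add_left_cancel hplus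
  exact Prod.ext (Matrix.transpose_injective hE) (twist_injective hC hF)

lemma exists_dualBlocks_eq (hC : IsUnit C) (hdiag : R.toBlocks₁₁ = R.toBlocks₂₂)
    (hoff : R.toBlocks₁₂ = R.toBlocks₂₁) : ∃ E F, dualBlocks C (E, F) = R := by
  have hsurj := LinearMap.surjective_of_injective (twist_injective hC)
  obtain ⟨F, hF⟩ := hsurj (R.toBlocks₁₁ - R.toBlocks₁₂)
  refine ⟨(R.toBlocks₁₁ + R.toBlocks₁₂)ᵀ, F, ?_⟩
  rw [dualBlocks_apply, hF, Matrix.transpose_transpose, ← Matrix.fromBlocks_toBlocks R, ← hdiag,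
    ← hoff, Matrix.fromBlocks_smul]
  congr 1 <;> simp <;> module

lemma natCast_card_smul_dualBlocks (C E F : Matrix V V ℂ) :
    (Fintype.card (V ⊕ V) : ℂ) • dualBlocks C (E, F) =
      Matrix.fromBlocks ((Fintype.card V : ℂ) • Eᵀ + (Fintype.card V : ℂ) • twist C F)
        ((Fintype.card V : ℂ) • Eᵀ - (Fintype.card V : ℂ) • twist C F)
        ((Fintype.card V : ℂ) • Eᵀ - (Fintype.card V : ℂ) • twist C F)
        ((Fintype.card V : ℂ) • Eᵀ + (Fintype.card V : ℂ) • twist C F) := by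
  rw [dualBlocks_apply, smul_smul, Fintype.card_sum, Matrix.fromBlocks_smul]
  congr 1 <;> push_cast <;> module

theorem isEigenvalueMatrix_matrixW_dualBlocks_iff (hA : IsTypeII A) (hB : IsTypeII B)
    (hc : ∀ i, c i ≠ 0) :
    IsEigenvalueMatrix (matrixW A B (Matrix.diagonal c))
        (schurInv (matrixW A B (Matrix.diagonal c))) (Matrix.fromBlocks P Q U T)
        ((Fintype.card (V ⊕ V) : ℂ) • dualBlocks (Matrix.diagonal c) (E, F)) ↔
      (IsEigenvalueMatrix A (schurInv A) E P ∧ IsEigenvalueMatrix A B F Q) ∧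
        IsEigenvalueMatrix B A (twist (Matrix.diagonal (c ^ 2)) F) U ∧
        IsEigenvalueMatrix (schurInv B) B E T := by
  have hscalar (i j : V) :
      c j / c i * ((Fintype.card V : ℂ) * (c i * F j i / c j)) = Fintype.card V * F j i ∧
        c i / c j * ((Fintype.card V : ℂ) * (c i * F j i / c j)) =
          Fintype.card V * (c i ^ 2 * F j i / c j ^ 2) := by
    have hi := hc i
    have hj := hc j
    constructor <;> field_simp
  rw [natCast_card_smul_dualBlocks, isEigenvalueMatrix_matrixW_iff hc,
    isEigenvalueMatrix_iff_mulVec_rowRatio hA.1 hA.schurInv,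
    isEigenvalueMatrix_iff_mulVec_rowRatio hA.1 hB,
    isEigenvalueMatrix_iff_mulVec_rowRatio hB.1 hA,
    isEigenvalueMatrix_iff_mulVec_rowRatio hB.schurInv.1 hB]
  simp only [Matrix.smul_apply, twist_diagonal_apply hc, Matrix.transpose_apply, smul_eq_mul,
    rowRatio_schurInv, hscalar, Pi.pow_apply,
    twist_diagonal_apply (c := c ^ 2) fun i => pow_ne_zero 2 (hc i)]
  exact ⟨fun h => ⟨⟨fun j i => (h i j).1.1, fun j i => (h i j).1.2⟩, fun i j => (h i j).2.1,
    fun j i => (h i j).2.2⟩, fun ⟨⟨hP, hQ⟩, hU, hT⟩ i j => ⟨⟨hP j i, hQ j i⟩, hU i j, hT j i⟩⟩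

lemma exists_dualBlocks_eq_of_mem_nomura_transpose (hA : IsTypeII A) (hB : IsTypeII B)
    (hc : ∀ i, c i ≠ 0) (hR : R ∈ nomura (matrixW A B (Matrix.diagonal c))ᵀ) :
    ∃ E F, dualBlocks (Matrix.diagonal c) (E, F) = R := by
  have hW := isTypeII_matrixW hA hB hc
  obtain ⟨S, hS⟩ := hR
  rw [← Matrix.transpose_transpose S, ← isEigenvalueMatrix_iff_transpose hW] at hS
  have entry {x y x' y' : V ⊕ V}
      (h : eigVec (matrixW A B (Matrix.diagonal c)) (schurInv (matrixW A B (Matrix.diagonal c)))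
          x y = eigVec (matrixW A B (Matrix.diagonal c))
          (schurInv (matrixW A B (Matrix.diagonal c))) x' y') : R x y = R x' y' :=
    mul_left_cancel₀ (natCast_card_ne_zero x)
      (hS.apply_eq_apply_of_eigVec_eq hW.1 hW.schurInv.1 h)
  refine exists_dualBlocks_eq (isUnit_diagonal hc) ?_ ?_ <;> ext i j <;> apply entry
  · rw [eigVec_matrixW_inl_inl, eigVec_matrixW_inr_inr]
  · rw [eigVec_matrixW_inl_inr, eigVec_matrixW_inr_inl]

theorem mem_nomura_matrixW_transpose_iff (hA : IsTypeII A) (hB : IsTypeII B) (hc : ∀ i, c i ≠ 0)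
    (hAB : nomura A = nomura B)
    (htwist : ∀ F ∈ nomura₂ A B, twist (Matrix.diagonal (c ^ 2)) F ∈ nomura₂ A B) :
    R ∈ nomura (matrixW A B (Matrix.diagonal c))ᵀ ↔
      ∃ p ∈ (Subalgebra.toSubmodule (nomura A)).prod (Subalgebra.toSubmodule (nomura₂ A B)),
        dualBlocks (Matrix.diagonal c) p = R := by
  have hW := isTypeII_matrixW hA hB hc
  constructor
  · intro hR
    obtain ⟨E, F, rfl⟩ := exists_dualBlocks_eq_of_mem_nomura_transpose hA hB hc hR
    obtain ⟨S, hS⟩ := hR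
    rw [← Matrix.transpose_transpose S, ← isEigenvalueMatrix_iff_transpose hW,
      ← Matrix.fromBlocks_toBlocks Sᵀ, isEigenvalueMatrix_matrixW_dualBlocks_iff hA hB hc] at hS
    exact ⟨(E, F), ⟨⟨_, hS.1.1⟩, ⟨_, hS.1.2⟩⟩, rfl⟩
  · rintro ⟨⟨E, F⟩, ⟨hE, hF⟩, rfl⟩
    obtain ⟨P, hP⟩ := id hE
    obtain ⟨Q, hQ⟩ := id hF
    obtain ⟨U, hU⟩ := htwist F hF
    obtain ⟨T, hT⟩ : E ∈ nomura B := hAB ▸ hE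
    exact ⟨_, (isEigenvalueMatrix_iff_transpose hW).1
      ((isEigenvalueMatrix_matrixW_dualBlocks_iff hA hB hc).2
        ⟨⟨hP, hQ⟩, hU.swap, hT.swap⟩)⟩

end DualBlocks

section ReducedAlgebra

lemma nonempty_algEquiv_fin_finrank_pi (K A : Type*) [Field K] [IsAlgClosed K] [CommRing A]
    [Algebra K A] [FiniteDimensional K A] [IsReduced A] :
    Nonempty (A ≃ₐ[K] (Fin (Module.finrank K A) → K)) := by
  have : IsArtinianRing A := isArtinian_of_tower K inferInstance
  let (m : MaximalSpectrum A) : Field (A ⧸ m.asIdeal) := Ideal.Quotient.field m.asIdeal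
  have := Fintype.ofFinite (MaximalSpectrum A)
  let e : A ≃ₐ[K] (MaximalSpectrum A → K) :=
    ((IsArtinianRing.equivPi A).restrictScalars K).trans
      (AlgEquiv.piCongrRight fun _ => (AlgEquiv.ofBijective (Algebra.ofId K _)
        IsAlgClosed.algebraMap_bijective_of_isIntegral).symm)
  have hcard : Fintype.card (MaximalSpectrum A) = Module.finrank K A := by
    rw [e.toLinearEquiv.finrank_eq, Module.finrank_fintype_fun_eq_card]
  exact ⟨e.trans (AlgEquiv.piCongrLeft K (fun _ => K) (Fintype.equivFinOfCardEq hcard))⟩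

variable {V : Type*} [Fintype V] [DecidableEq V]

open scoped IsMulCommutative in
theorem exists_isPrincipalIdempotentBasis (N : Subalgebra ℂ (Matrix V V ℂ)) [IsMulCommutative N]
    [IsReduced N] :
    ∃ E : Fin (Module.finrank ℂ N) → Matrix V V ℂ, IsPrincipalIdempotentBasis N E := by
  obtain ⟨e⟩ := nonempty_algEquiv_fin_finrank_pi ℂ N
  let f : (Fin (Module.finrank ℂ N) → ℂ) →ₐ[ℂ] Matrix V V ℂ := N.val.comp e.symm.toAlgHom
  have hf : Function.Injective f := Subtype.val_injective.comp e.symm.injective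
  have hrange : f.range = N := by
    rw [AlgHom.range_comp, (AlgHom.range_eq_top _).2 e.symm.surjective, Algebra.map_top,
      Subalgebra.range_val]
  have hidem := (CompleteOrthogonalIdempotents.single
    fun _ : Fin (Module.finrank ℂ N) => ℂ).map f.toRingHom
  have hbasis : f.toLinearMap ∘ Pi.basisFun ℂ _ = fun i => f (Pi.single i 1) := by
    ext i
    simp
  refine ⟨fun i => f (Pi.single i 1), ?_, ?_, hidem.idem, fun i j hij => hidem.ortho hij,
    hidem.complete⟩
  · rw [← hbasis]
    exact (Pi.basisFun ℂ _).linearIndependent.map' _ (LinearMap.ker_eq_bot.2 hf)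
  · rw [← hbasis, Set.range_comp, Submodule.span_image, (Pi.basisFun ℂ _).span_eq,
      Submodule.map_top]
    exact congrArg Subalgebra.toSubmodule hrange

end ReducedAlgebra

section Nomura

variable {V : Type*} [Fintype V] [DecidableEq V] {A B : Matrix V V ℂ}

theorem isMulCommutative_nomura₂ (hA : ∀ i j, A i j ≠ 0) (hB : IsTypeII B) :
    IsMulCommutative (nomura₂ A B) := by
  refine ⟨⟨fun ⟨R, S, hS⟩ ⟨R', S', hS'⟩ => Subtype.ext ?_⟩⟩
  have hmul := hS'.mul hS
  rw [Matrix.hadamard_comm] at hmul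
  exact (hS.mul hS').unique_left hA hB hmul

theorem isReduced_nomura₂ (hA : ∀ i j, A i j ≠ 0) (hB : IsTypeII B) :
    IsReduced (nomura₂ A B) := by
  refine (isReduced_iff_pow_one_lt 2 one_lt_two).2 fun ⟨R, S, hS⟩ hR => Subtype.ext ?_
  have hsq : R * R = 0 := by simpa [sq] using congrArg Subtype.val hR
  have hmul := hS.mul hS
  rw [hsq] at hmul
  have hzero : S = 0 := by
    ext i j
    exact mul_self_eq_zero.1 (congrFun₂ (hmul.unique_right hA hB.1 .zero) i j)
  rw [hzero] at hS
  exact hS.unique_left hA hB .zero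

theorem exists_isPrincipalIdempotentBasis_nomura₂ (hA : ∀ i j, A i j ≠ 0) (hB : IsTypeII B) :
    ∃ E : Fin (Module.finrank ℂ (nomura₂ A B)) → Matrix V V ℂ,
      IsPrincipalIdempotentBasis (nomura₂ A B) E :=
  have := isMulCommutative_nomura₂ hA hB
  have := isReduced_nomura₂ hA hB
  exists_isPrincipalIdempotentBasis _

end Nomura

section IdempotentBases

variable {V ι κ : Type*} [Fintype V] [DecidableEq V] [Fintype ι] [Fintype κ]

lemma IsPrincipalIdempotentBasis.finrank_eq_card {N : Subalgebra ℂ (Matrix V V ℂ)}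
    {E : ι → Matrix V V ℂ} (hE : IsPrincipalIdempotentBasis N E) :
    Module.finrank ℂ N = Fintype.card ι := by
  rw [← finrank_span_eq_card hE.1, hE.2.1, Subalgebra.finrank_toSubmodule]

lemma IsSchurIdempotentBasis.finrank_eq_card {N : Subalgebra ℂ (Matrix V V ℂ)}
    {E : ι → Matrix V V ℂ} (hE : IsSchurIdempotentBasis N E) :
    Module.finrank ℂ N = Fintype.card ι := by
  rw [← finrank_span_eq_card hE.1, hE.2.1, Subalgebra.finrank_toSubmodule]

lemma IsPrincipalIdempotentBasis.mem {N : Subalgebra ℂ (Matrix V V ℂ)} {E : ι → Matrix V V ℂ}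
    (hE : IsPrincipalIdempotentBasis N E) (i : ι) : E i ∈ N := by
  rw [← Subalgebra.mem_toSubmodule, ← hE.2.1]
  exact Submodule.subset_span ⟨i, rfl⟩

theorem isSchurIdempotentBasis_of_isPrincipalIdempotentBasis {A : Matrix V V ℂ}
    {E T : ι → Matrix V V ℂ} (hA : IsTypeII A) (hE : IsPrincipalIdempotentBasis (nomura Aᵀ) E)
    (hT : ∀ i, IsEigenvalueMatrix A (schurInv A) (T i) ((Fintype.card V : ℂ) • E i)) :
    IsSchurIdempotentBasis (nomura A) T := by
  obtain ⟨hli, hspan, hidem, hortho, hsum⟩ := hE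
  have hdual (i : ι) := (isEigenvalueMatrix_iff_transpose hA).1 (hT i)
  have unique {R S S' : Matrix V V ℂ} (h : IsEigenvalueMatrix Aᵀ (schurInv Aᵀ) R Sᵀ)
      (h' : IsEigenvalueMatrix Aᵀ (schurInv Aᵀ) R S'ᵀ) : S = S' :=
    Matrix.transpose_injective (h.unique_right hA.transpose.1 hA.transpose.schurInv.1 h')
  have hcomb (a : ι → ℂ) :
      IsEigenvalueMatrix Aᵀ (schurInv Aᵀ) (∑ i, a i • E i) (∑ i, a i • T i)ᵀ := by
    simpa [Matrix.transpose_sum] using IsEigenvalueMatrix.sum_smul hdual a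
  refine ⟨Fintype.linearIndependent_iff.2 fun a ha => ?_, le_antisymm ?_ fun S hS => ?_,
    fun i => unique (R := E i) ?_ (hdual i), fun i j hij => unique (R := 0) ?_ .zero,
    unique (R := 1) ?_ .one⟩
  · have hzero := hcomb a
    rw [ha] at hzero
    exact Fintype.linearIndependent_iff.1 hli a
      (hzero.unique_left hA.transpose.1 hA.transpose.schurInv .zero)
  · exact Submodule.span_le.2 (Set.range_subset_iff.2 fun i => ⟨_, hT i⟩)
  · obtain ⟨R, hR, hRS⟩ := exists_isEigenvalueMatrix_transpose hA hS
    rw [← Subalgebra.mem_toSubmodule, ← hspan] at hR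
    obtain ⟨a, rfl⟩ := (Submodule.mem_span_range_iff_exists_fun ℂ).1 hR
    rw [unique hRS (hcomb a)]
    exact Submodule.sum_smul_mem _ _ fun i _ => Submodule.subset_span ⟨i, rfl⟩
  · have h := (hdual i).mul (hdual i)
    rwa [hidem] at h
  · have h := (hdual i).mul (hdual j)
    rwa [hortho i j hij] at h
  · simpa [hsum] using hcomb 1

theorem isPrincipalIdempotentBasis_dualBlocks {N N' : Subalgebra ℂ (Matrix V V ℂ)}
    {M : Subalgebra ℂ (Matrix (V ⊕ V) (V ⊕ V) ℂ)} {C : Matrix V V ℂ} {E : ι → Matrix V V ℂ}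
    {F : κ → Matrix V V ℂ} (hC : IsUnit C)
    (hM : ∀ R, R ∈ M ↔ ∃ p ∈ (Subalgebra.toSubmodule N).prod (Subalgebra.toSubmodule N'),
      dualBlocks C p = R)
    (hE : IsPrincipalIdempotentBasis N E) (hF : IsPrincipalIdempotentBasis N' F) :
    IsPrincipalIdempotentBasis M
      (Sum.elim (fun i => dualBlocks C (E i, 0)) fun j => dualBlocks C (0, F j)) := by
  obtain ⟨hEli, hEspan, hEidem, hEortho, hEsum⟩ := hE
  obtain ⟨hFli, hFspan, hFidem, hFortho, hFsum⟩ := hF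
  have hcomp : (Sum.elim (fun i => dualBlocks C (E i, 0)) fun j => dualBlocks C (0, F j)) =
      dualBlocks C ∘ Sum.elim (LinearMap.inl ℂ _ _ ∘ E) (LinearMap.inr ℂ _ _ ∘ F) :=
    (Sum.comp_elim ..).symm
  refine ⟨?_, ?_, ?_, ?_, ?_⟩
  · rw [hcomp]
    exact (linearIndependent_inl_union_inr' hEli hFli).map' _
      (LinearMap.ker_eq_bot.2 (dualBlocks_injective hC))
  · rw [hcomp, Set.range_comp, Submodule.span_image, Set.Sum.elim_range, Set.range_comp,
      Set.range_comp, LinearMap.span_inl_union_inr, hEspan, hFspan]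
    exact Submodule.ext fun R => (hM R).symm
  · rintro (i | j) <;> simp [dualBlocks_mul_dualBlocks hC, hEidem, hFidem]
  · have hzero : dualBlocks C (0, 0) = 0 := map_zero _
    rintro (i | i) (j | j) hij
    · simp [dualBlocks_mul_dualBlocks hC, hEortho j i fun h => hij (congrArg _ h.symm), hzero]
    · simp [dualBlocks_mul_dualBlocks hC, hzero]
    · simp [dualBlocks_mul_dualBlocks hC, hzero]
    · simp [dualBlocks_mul_dualBlocks hC, hFortho j i fun h => hij (congrArg _ h.symm), hzero]
  · have hsum : ∑ i, (E i, (0 : Matrix V V ℂ)) + ∑ j, ((0 : Matrix V V ℂ), F j) = 1 := by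
      simp [Prod.ext_iff, Prod.fst_sum, Prod.snd_sum, hEsum, hFsum]
    rw [← dualBlocks_one hC, ← hsum, map_add, map_sum, map_sum, Fintype.sum_sum_type]
    rfl

end IdempotentBases

section IdempotentsOfW

variable {V ι κ : Type*} [Fintype V] [DecidableEq V] [Fintype ι] [Fintype κ]
  {A B : Matrix V V ℂ} {c : V → ℂ} {E : ι → Matrix V V ℂ} {F : κ → Matrix V V ℂ}

theorem isPrincipalIdempotentBasis_nomura_matrixW_transpose (hA : IsTypeII A) (hB : IsTypeII B)
    (hc : ∀ i, c i ≠ 0) (hAB : nomura A = nomura B)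
    (htwist : ∀ R ∈ nomura₂ A B, twist (Matrix.diagonal (c ^ 2)) R ∈ nomura₂ A B)
    (hE : IsPrincipalIdempotentBasis (nomura A) E)
    (hF : IsPrincipalIdempotentBasis (nomura₂ A B) F) :
    IsPrincipalIdempotentBasis (nomura (matrixW A B (Matrix.diagonal c))ᵀ)
      (Sum.elim (fun i => dualBlocks (Matrix.diagonal c) (E i, 0))
        fun j => dualBlocks (Matrix.diagonal c) (0, F j)) :=
  isPrincipalIdempotentBasis_dualBlocks (isUnit_diagonal hc)
    (fun _ => mem_nomura_matrixW_transpose_iff hA hB hc hAB htwist) hE hF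

theorem isSchurIdempotentBasis_nomura_matrixW (hA : IsTypeII A) (hB : IsTypeII B)
    (hc : ∀ i, c i ≠ 0) (hAB : nomura A = nomura B)
    (htwist : ∀ R ∈ nomura₂ A B, twist (Matrix.diagonal (c ^ 2)) R ∈ nomura₂ A B)
    (hE : IsPrincipalIdempotentBasis (nomura A) E)
    (hF : IsPrincipalIdempotentBasis (nomura₂ A B) F) :
    IsSchurIdempotentBasis (nomura (matrixW A B (Matrix.diagonal c)))
      (Sum.elim (fun i => Matrix.fromBlocks (Theta A (E i)) 0 0 (Theta B (E i))ᵀ)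
        fun j => Matrix.fromBlocks 0 (Theta₂ A B (F j))
          (Theta₂ A B (twist (Matrix.diagonal (c ^ 2)) (F j)))ᵀ 0) := by
  refine isSchurIdempotentBasis_of_isPrincipalIdempotentBasis (isTypeII_matrixW hA hB hc)
    (isPrincipalIdempotentBasis_nomura_matrixW_transpose hA hB hc hAB htwist hE hF) ?_
  have hzero : IsEigenvalueMatrix B A (twist (Matrix.diagonal (c ^ 2)) 0) 0 := by
    rw [map_zero]
    exact .zero
  rintro (i | j)
  · have hEB : E i ∈ nomura B := hAB ▸ hE.mem i
    exact (isEigenvalueMatrix_matrixW_dualBlocks_iff hA hB hc).2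
      ⟨⟨isEigenvalueMatrix_Theta₂ (hE.mem i), .zero⟩, hzero, (isEigenvalueMatrix_Theta₂ hEB).swap⟩
  · exact (isEigenvalueMatrix_matrixW_dualBlocks_iff hA hB hc).2
      ⟨⟨.zero, isEigenvalueMatrix_Theta₂ (hF.mem j)⟩,
        (isEigenvalueMatrix_Theta₂ (htwist _ (hF.mem j))).swap, .zero⟩

end IdempotentsOfW

end JonesPairs

theorem mainTheorem1_general {V : Type*} [Fintype V] [DecidableEq V] (A B C G T : Matrix V V ℂ)
    (hA : IsTypeII A) (hB : IsTypeII B) (hG : IsEigenvalueMatrix A B G T) (hG0 : ∀ i j, G i j ≠ 0)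
    (hT : IsUnit T) (hCdiag : C.IsDiag) (hCunit : IsUnit C) (hGC : Gᵀ = (C ^ 2)⁻¹ * G * C ^ 2) :
    IsTypeII (matrixW A B C) ∧
    Module.finrank ℂ (nomura A) = Module.finrank ℂ (nomura₂ A B) ∧
    (∃ E : Fin (Module.finrank ℂ (nomura A)) → Matrix V V ℂ,
      IsPrincipalIdempotentBasis (nomura A) E) ∧
    (∃ F : Fin (Module.finrank ℂ (nomura A)) → Matrix V V ℂ,
      IsPrincipalIdempotentBasis (nomura₂ A B) F) ∧
    (∀ (r : ℕ) (E F : Fin r → Matrix V V ℂ),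
      IsPrincipalIdempotentBasis (nomura A) E →
      IsPrincipalIdempotentBasis (nomura₂ A B) F →
      IsSchurIdempotentBasis (nomura (matrixW A B C))
        (Sum.elim
          (fun i : Fin r =>
            Matrix.fromBlocks (Theta A (E i)) 0 0 (Theta B (E i))ᵀ)
          (fun j : Fin r =>
            Matrix.fromBlocks 0 (Theta₂ A B (F j))
              (Theta₂ A B (C ^ 2 * (F j)ᵀ * (C ^ 2)⁻¹))ᵀ 0)) ∧
      IsPrincipalIdempotentBasis (nomura (matrixW A B C)ᵀ)
        (Sum.elim
          (fun i : Fin r =>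
            (1 / 2 : ℂ) • Matrix.fromBlocks (E i)ᵀ (E i)ᵀ (E i)ᵀ (E i)ᵀ)
          (fun j : Fin r =>
            (1 / 2 : ℂ) • Matrix.fromBlocks
              (C * (F j)ᵀ * C⁻¹) (-(C * (F j)ᵀ * C⁻¹))
              (-(C * (F j)ᵀ * C⁻¹)) (C * (F j)ᵀ * C⁻¹)))) ∧
    Module.finrank ℂ (nomura (matrixW A B C)) = 2 * Module.finrank ℂ (nomura A) ∧
    Module.finrank ℂ (nomura (matrixW A B C)ᵀ) = 2 * Module.finrank ℂ (nomura A) := by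
  obtain ⟨c, rfl⟩ : ∃ c, Matrix.diagonal c = C := ⟨C.diag, hCdiag.diagonal_diag⟩
  have hc (i : V) : c i ≠ 0 := (Pi.isUnit_iff.1 (Matrix.isUnit_diagonal.1 hCunit) i).ne_zero
  have hN := nomura_eq_nomura hA hB hG hG0 hT
  rw [Matrix.diagonal_pow] at hGC ⊢
  have htwist (R : Matrix V V ℂ) (hR : R ∈ nomura₂ A B) :=
    twist_mem_nomura₂ hA hB hG hG0 hT (fun i => pow_ne_zero 2 (hc i)) hGC hR
  have hrank := finrank_nomura_eq_finrank_nomura₂ hA hB hG hG0 hT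
  obtain ⟨E, hE⟩ : ∃ E : Fin (Module.finrank ℂ (nomura A)) → Matrix V V ℂ,
      IsPrincipalIdempotentBasis (nomura A) E :=
    exists_isPrincipalIdempotentBasis_nomura₂ hA.1 hA.schurInv
  obtain ⟨F, hF⟩ : ∃ F : Fin (Module.finrank ℂ (nomura A)) → Matrix V V ℂ,
      IsPrincipalIdempotentBasis (nomura₂ A B) F :=
    hrank ▸ exists_isPrincipalIdempotentBasis_nomura₂ hA.1 hB
  have hSchur := isSchurIdempotentBasis_nomura_matrixW hA hB hc hN htwist hE hF
  have hprincipal := isPrincipalIdempotentBasis_nomura_matrixW_transpose hA hB hc hN htwist hE hF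
  refine ⟨isTypeII_matrixW hA hB hc, hrank, ⟨E, hE⟩, ⟨F, hF⟩,
    fun r E F hE hF => ⟨isSchurIdempotentBasis_nomura_matrixW hA hB hc hN htwist hE hF, ?_⟩, ?_, ?_⟩
  · simp only [← dualBlocks_left (Matrix.diagonal c), ← dualBlocks_right]
    exact isPrincipalIdempotentBasis_nomura_matrixW_transpose hA hB hc hN htwist hE hF
  · rw [hSchur.finrank_eq_card, Fintype.card_sum, Fintype.card_fin, two_mul]
  · rw [hprincipal.finrank_eq_card, Fintype.card_sum, Fintype.card_fin, two_mul]

theorem mainTheorem1 (n : ℕ) (A B C : Matrix (Fin n) (Fin n) ℂ)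
    (hAB : IsInvertibleJonesPair A B)
    (hCdiag : C.IsDiag) (hCunit : IsUnit C)
    (hAC : Aᵀ = (C ^ 2)⁻¹ * A * C ^ 2) :
    IsTypeII (matrixW A B C) ∧
    Module.finrank ℂ (nomura A) = Module.finrank ℂ (nomura₂ A B) ∧
    (∃ E : Fin (Module.finrank ℂ (nomura A)) → Matrix (Fin n) (Fin n) ℂ,
      IsPrincipalIdempotentBasis (nomura A) E) ∧
    (∃ F : Fin (Module.finrank ℂ (nomura A)) → Matrix (Fin n) (Fin n) ℂ,
      IsPrincipalIdempotentBasis (nomura₂ A B) F) ∧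
    (∀ (r : ℕ) (E F : Fin r → Matrix (Fin n) (Fin n) ℂ),
      IsPrincipalIdempotentBasis (nomura A) E →
      IsPrincipalIdempotentBasis (nomura₂ A B) F →
      IsSchurIdempotentBasis (nomura (matrixW A B C))
        (Sum.elim
          (fun i : Fin r =>
            Matrix.fromBlocks (Theta A (E i)) 0 0 (Theta B (E i))ᵀ)
          (fun j : Fin r =>
            Matrix.fromBlocks 0 (Theta₂ A B (F j))
              (Theta₂ A B (C ^ 2 * (F j)ᵀ * (C ^ 2)⁻¹))ᵀ 0)) ∧
      IsPrincipalIdempotentBasis (nomura (matrixW A B C)ᵀ)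
        (Sum.elim
          (fun i : Fin r =>
            (1 / 2 : ℂ) • Matrix.fromBlocks (E i)ᵀ (E i)ᵀ (E i)ᵀ (E i)ᵀ)
          (fun j : Fin r =>
            (1 / 2 : ℂ) • Matrix.fromBlocks
              (C * (F j)ᵀ * C⁻¹) (-(C * (F j)ᵀ * C⁻¹))
              (-(C * (F j)ᵀ * C⁻¹)) (C * (F j)ᵀ * C⁻¹)))) ∧
    Module.finrank ℂ (nomura (matrixW A B C)) = 2 * Module.finrank ℂ (nomura A) ∧
    Module.finrank ℂ (nomura (matrixW A B C)ᵀ) = 2 * Module.finrank ℂ (nomura A) := by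
  have hA := hAB.1.1.isTypeII_left hAB.2.1 hAB.2.2
  exact mainTheorem1_general A B C A B hA (hAB.1.isTypeII_right hA) hAB.1.1.isEigenvalueMatrix
    hAB.2.1 hAB.2.2 hCdiag hCunit hAC
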